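/- For a real matrix $A\in\mathbb{R}^{p\times q}$ let $\|A\|_{\mathrm{tr}}=\sum_{i=1}^{\min(p,q)}\sigma_i(A)$ be its trace norm, where $\sigma_i(A)$ are the singular values of $A$. Let $X\in\mathbb{R}^{m\times n}$ have $\operatorname{rank}(X)=r$, let $d\ge r$ be an integer, and define the bi-trace and tri-trace quasi-norms of $X$ by $$\|X\|_{\text{Bi-tr}}=\min_{\substack{U\in\mathbb{R}^{m\times d},\,V\in\mathbb{R}^{n\times d}\\ X=UV^T}}\|U\|_{\mathrm{tr}}\|V\|_{\mathrm{tr}},\qquad \|X\|_{\text{Tri-tr}}=\min_{\substack{U\in\mathbb{R}^{m\times d},\,V\in\mathbb{R}^{d\times d},\,W\in\mathbb{R}^{n\times d}\\ X=UVW^T}}\|U\|_{\mathrm{tr}}\|V\|_{\mathrm{tr}}\|W\|_{\mathrm{tr}}.$$ Then both minima are attained, and $$\|X\|_{\mathrm{tr}}\le\|X\|_{\text{Bi-tr}}\le r\,\|X\|_{\mathrm{tr}},$$ $$\|X\|_{\mathrm{tr}}\le\|X\|_{\text{Bi-tr}}\le\|X\|_{\text{Tri-tr}}\le r^2\,\|X\|_{\mathrm{tr}}.$$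 -/

import Mathlib

/-- The `i`-th singular value (counted from `0`, in decreasing order, with multiplicity) of a real
`m × n` matrix, as a linear map `ℝⁿ → ℝᵐ` between Euclidean spaces. -/
noncomputable def matSingularValue {m n : ℕ} (X : Matrix (Fin m) (Fin n) ℝ) (i : ℕ) : ℝ :=
  (Matrix.toEuclideanLin X).singularValues i

/-- The trace norm `‖X‖_tr`: the sum of the `min (m, n)` singular values of `X`. -/
noncomputable def trNorm {m n : ℕ} (X : Matrix (Fin m) (Fin n) ℝ) : ℝ :=
  ∑ i ∈ Finset.range (min m n), matSingularValue X i

/-- The values `‖U‖_tr ‖V‖_tr` over all factorizations `X = U Vᵀ` of inner dimension `d`. -/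
def biTrValues {m n : ℕ} (d : ℕ) (X : Matrix (Fin m) (Fin n) ℝ) : Set ℝ :=
  {c | ∃ (U : Matrix (Fin m) (Fin d) ℝ) (V : Matrix (Fin n) (Fin d) ℝ),
    X = U * V.transpose ∧ c = trNorm U * trNorm V}

/-- The values `‖U‖_tr ‖V‖_tr ‖W‖_tr` over all factorizations `X = U V Wᵀ` of inner
dimension `d`. -/
def triTrValues {m n : ℕ} (d : ℕ) (X : Matrix (Fin m) (Fin n) ℝ) : Set ℝ :=
  {c | ∃ (U : Matrix (Fin m) (Fin d) ℝ) (V : Matrix (Fin d) (Fin d) ℝ)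
      (W : Matrix (Fin n) (Fin d) ℝ),
    X = U * V * W.transpose ∧ c = trNorm U * trNorm V * trNorm W}

/-- The bi-trace quasi-norm with inner dimension `d`. For `rank X ≤ d` the infimum is a minimum;
this is claimed in the theorem. -/
noncomputable def biTrNorm {m n : ℕ} (d : ℕ) (X : Matrix (Fin m) (Fin n) ℝ) : ℝ :=
  sInf (biTrValues d X)

/-- The tri-trace quasi-norm with inner dimension `d`. For `rank X ≤ d` the infimum is a minimum;
this is claimed in the theorem. -/
noncomputable def triTrNorm {m n : ℕ} (d : ℕ) (X : Matrix (Fin m) (Fin n) ℝ) : ℝ :=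
  sInf (triTrValues d X)

open Module
open scoped InnerProductSpace

/-! The trace norm is dual to the operator norm: it is the maximum of the trace of D X over
contractions D. This gives the triangle inequality, transpose invariance and the bound by the sum of
column norms. Lower bounds: the trace norm is submultiplicative (`trNorm_mul_le`), and a
factorization U V Wᵀ is also a two-factor one, (U V) Wᵀ. Upper bounds: splitting the singular value
decomposition evenly gives factors whose columns have length at most √σᵢ, so each has trace norm at
most ∑ √σᵢ, and Cauchy–Schwarz gives (∑ √σᵢ)² ≤ r ∑ σᵢ. Inserting a diagonal projection of rank r
costs another factor r. Attainment: scalars move freely between factors, so all but the last may be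
given trace norm 1, and compactness applies. -/

theorem finrank_range_toEuclideanLin {m n : ℕ} (X : Matrix (Fin m) (Fin n) ℝ) :
    finrank ℝ (LinearMap.range X.toEuclideanLin) = X.rank := by
  rw [Matrix.toEuclideanLin, Matrix.toLpLin_eq_toLin]
  exact (X.rank_eq_finrank_range_toLin _ _).symm

theorem matSingularValue_nonneg {m n : ℕ} (X : Matrix (Fin m) (Fin n) ℝ) (i : ℕ) :
    0 ≤ matSingularValue X i :=
  LinearMap.singularValues_nonneg _ _

theorem matSingularValue_eq_zero {m n : ℕ} (X : Matrix (Fin m) (Fin n) ℝ) {i : ℕ}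
    (hi : X.rank ≤ i) : matSingularValue X i = 0 := by
  rw [matSingularValue, LinearMap.singularValues_eq_zero_iff_le_finrank_range,
    finrank_range_toEuclideanLin]
  exact hi

theorem Finset.sum_range_eq_of_forall_ge_eq_zero {f : ℕ → ℝ} {r N : ℕ} (hN : r ≤ N)
    (hf : ∀ i, r ≤ i → f i = 0) : ∑ i ∈ Finset.range N, f i = ∑ i ∈ Finset.range r, f i :=
  (Finset.sum_subset (Finset.range_mono hN) fun i _ hi => hf i (by simpa using hi)).symm

theorem rank_le_left {m n : ℕ} (X : Matrix (Fin m) (Fin n) ℝ) : X.rank ≤ m := by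
  simpa using X.rank_le_card_height

theorem rank_le_right {m n : ℕ} (X : Matrix (Fin m) (Fin n) ℝ) : X.rank ≤ n := by
  simpa using X.rank_le_card_width

theorem trNorm_eq_sum_range_rank {m n : ℕ} (X : Matrix (Fin m) (Fin n) ℝ) :
    trNorm X = ∑ i ∈ Finset.range X.rank, matSingularValue X i :=
  Finset.sum_range_eq_of_forall_ge_eq_zero (le_min (rank_le_left X) (rank_le_right X))
    fun _ hi => matSingularValue_eq_zero X hi

/-- An orthonormal basis of right singular vectors: its image is orthogonal, and the squared norms
of the images are the squared singular values. -/
theorem exists_rightSingularBasis {m n : ℕ} (X : Matrix (Fin m) (Fin n) ℝ) :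
    ∃ e : OrthonormalBasis (Fin n) ℝ (EuclideanSpace ℝ (Fin n)),
      (∀ i, ‖X.toEuclideanLin (e i)‖ = matSingularValue X i) ∧
      ∀ i j, i ≠ j → ⟪X.toEuclideanLin (e i), X.toEuclideanLin (e j)⟫_ℝ = 0 := by
  set T := X.toEuclideanLin with hT
  have hn : finrank ℝ (EuclideanSpace ℝ (Fin n)) = n := by simp
  let e := T.isSymmetric_adjoint_comp_self.eigenvectorBasis hn
  have key : ∀ i j, ⟪T (e i), T (e j)⟫_ℝ =
      T.isSymmetric_adjoint_comp_self.eigenvalues hn j * ⟪e i, e j⟫_ℝ := by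
    intro i j
    rw [← LinearMap.adjoint_inner_right, ← LinearMap.comp_apply,
      T.isSymmetric_adjoint_comp_self.apply_eigenvectorBasis hn j, inner_smul_right]
    simp [e]
  refine ⟨e, fun i => ?_, fun i j hij => ?_⟩
  · rw [← sq_eq_sq₀ (norm_nonneg _) (matSingularValue_nonneg X i), ← real_inner_self_eq_norm_sq,
      key, matSingularValue, ← hT, T.sq_singularValues_fin hn]
    simp
  · rw [key, e.orthonormal.2 hij, mul_zero]

theorem trNorm_eq_sum_fin {m n : ℕ} (X : Matrix (Fin m) (Fin n) ℝ) :
    trNorm X = ∑ i : Fin n, matSingularValue X i := by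
  rw [trNorm_eq_sum_range_rank, Fin.sum_univ_eq_sum_range (fun i => matSingularValue X i),
    Finset.sum_range_eq_of_forall_ge_eq_zero (rank_le_right X)
      fun _ hi => matSingularValue_eq_zero X hi]

theorem exists_trNorm_eq_sum_norm {m n : ℕ} (X : Matrix (Fin m) (Fin n) ℝ) :
    ∃ e : OrthonormalBasis (Fin n) ℝ (EuclideanSpace ℝ (Fin n)),
      trNorm X = ∑ i, ‖X.toEuclideanLin (e i)‖ := by
  obtain ⟨e, he, -⟩ := exists_rightSingularBasis X
  exact ⟨e, by simp [trNorm_eq_sum_fin, he]⟩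

/-! ### Duality with contractions. -/

theorem trace_comp_le_trNorm {m n : ℕ} (X : Matrix (Fin m) (Fin n) ℝ)
    (D : EuclideanSpace ℝ (Fin m) →ₗ[ℝ] EuclideanSpace ℝ (Fin n)) (hD : ∀ y, ‖D y‖ ≤ ‖y‖) :
    LinearMap.trace ℝ _ (D ∘ₗ X.toEuclideanLin) ≤ trNorm X := by
  obtain ⟨e, he⟩ := exists_trNorm_eq_sum_norm X
  rw [LinearMap.trace_eq_sum_inner _ e, he]
  refine Finset.sum_le_sum fun i _ => (real_inner_le_norm _ _).trans ?_
  simpa using hD (X.toEuclideanLin (e i))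

/-- The maximizer is the partial isometry of the polar decomposition, reversed: it sends left
singular vectors back to right ones. -/
theorem exists_trace_comp_eq_trNorm {m n : ℕ} (X : Matrix (Fin m) (Fin n) ℝ) :
    ∃ D : EuclideanSpace ℝ (Fin m) →ₗ[ℝ] EuclideanSpace ℝ (Fin n), (∀ y, ‖D y‖ ≤ ‖y‖) ∧
      LinearMap.trace ℝ _ (D ∘ₗ X.toEuclideanLin) = trNorm X := by
  obtain ⟨e, he, horth⟩ := exists_rightSingularBasis X
  set T := X.toEuclideanLin
  -- When `T (e i) = 0`, the convention `0⁻¹ = 0` makes `u i = 0`.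
  let u : Fin n → EuclideanSpace ℝ (Fin m) := fun i => ‖T (e i)‖⁻¹ • T (e i)
  let D : EuclideanSpace ℝ (Fin m) →ₗ[ℝ] EuclideanSpace ℝ (Fin n) :=
    ∑ i, ((innerₛₗ ℝ (u i)).smulRight (e i))
  have hDe : ∀ y, D y = ∑ i, ⟪u i, y⟫_ℝ • e i := fun y => by simp [D]
  have hinner : ∀ j y, ⟪e j, D y⟫_ℝ = ⟪u j, y⟫_ℝ := fun j y => by
    rw [hDe, e.orthonormal.inner_right_fintype]
  refine ⟨D, fun y => ?_, ?_⟩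
  · have hu : Orthonormal ℝ fun i : {i // T (e i) ≠ 0} => u i := by
      refine ⟨fun i => norm_smul_inv_norm (𝕜 := ℝ) i.2, fun i j hij => ?_⟩
      simp only [u, inner_smul_left, inner_smul_right]
      rw [horth _ _ fun h => hij (Subtype.ext h)]
      simp
    -- By Parseval the left side is the sum of the squared coefficients of `y` along the `u i`;
    -- Bessel bounds it.
    rw [← sq_le_sq₀ (norm_nonneg _) (norm_nonneg _), ← e.sum_sq_norm_inner_right (D y)]
    refine le_trans (le_of_eq ?_) (hu.sum_inner_products_le y (s := Finset.univ))
    simp only [hinner]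
    rw [← Finset.sum_filter_of_ne (p := fun i => T (e i) ≠ 0),
      ← Finset.sum_subtype_eq_sum_filter, Finset.subtype_univ]
    intro i _ hi h
    simp [u, h] at hi
  · rw [LinearMap.trace_eq_sum_inner _ e, trNorm_eq_sum_fin]
    refine Finset.sum_congr rfl fun i _ => ?_
    rw [LinearMap.comp_apply, hinner, ← he]
    simp only [u, inner_smul_left, real_inner_self_eq_norm_sq]
    by_cases h : ‖T (e i)‖ = 0
    · simp [h]
    · simp; field_simp

theorem trNorm_le_sum_norm {m n : ℕ} (X : Matrix (Fin m) (Fin n) ℝ)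
    (b : OrthonormalBasis (Fin n) ℝ (EuclideanSpace ℝ (Fin n))) :
    trNorm X ≤ ∑ i, ‖X.toEuclideanLin (b i)‖ := by
  obtain ⟨D, hD, h⟩ := exists_trace_comp_eq_trNorm X
  rw [← h, LinearMap.trace_eq_sum_inner _ b]
  refine Finset.sum_le_sum fun i _ => (real_inner_le_norm _ _).trans ?_
  simpa using hD (X.toEuclideanLin (b i))

/-! ### Norm properties, submultiplicativity and transposition. -/

theorem trNorm_nonneg {m n : ℕ} (X : Matrix (Fin m) (Fin n) ℝ) : 0 ≤ trNorm X :=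
  Finset.sum_nonneg fun _ _ => matSingularValue_nonneg X _

theorem trNorm_add_le {m n : ℕ} (X Y : Matrix (Fin m) (Fin n) ℝ) :
    trNorm (X + Y) ≤ trNorm X + trNorm Y := by
  obtain ⟨D, hD, h⟩ := exists_trace_comp_eq_trNorm (X + Y)
  rw [← h, map_add, LinearMap.comp_add, map_add]
  exact add_le_add (trace_comp_le_trNorm X D hD) (trace_comp_le_trNorm Y D hD)

theorem trNorm_smul_le {m n : ℕ} (c : ℝ) (X : Matrix (Fin m) (Fin n) ℝ) :
    trNorm (c • X) ≤ |c| * trNorm X := by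
  obtain ⟨e, he⟩ := exists_trNorm_eq_sum_norm X
  refine (trNorm_le_sum_norm _ e).trans_eq ?_
  simp [he, norm_smul, Finset.mul_sum]

theorem trNorm_smul {m n : ℕ} (c : ℝ) (X : Matrix (Fin m) (Fin n) ℝ) :
    trNorm (c • X) = |c| * trNorm X := by
  obtain rfl | hc := eq_or_ne c 0
  · exact le_antisymm (trNorm_smul_le _ _) (by simpa using trNorm_nonneg _)
  refine le_antisymm (trNorm_smul_le c X) ?_
  have h := trNorm_smul_le c⁻¹ (c • X)
  rw [smul_smul, inv_mul_cancel₀ hc, one_smul, abs_inv] at h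
  rwa [le_inv_mul_iff₀ (abs_pos.2 hc)] at h

theorem norm_toEuclideanLin_le_trNorm_mul {m n : ℕ} (X : Matrix (Fin m) (Fin n) ℝ)
    (x : EuclideanSpace ℝ (Fin n)) : ‖X.toEuclideanLin x‖ ≤ trNorm X * ‖x‖ := by
  obtain ⟨e, he⟩ := exists_trNorm_eq_sum_norm X
  conv_lhs => rw [← e.sum_repr' x, map_sum]
  refine (norm_sum_le _ _).trans ?_
  rw [he, Finset.sum_mul]
  refine Finset.sum_le_sum fun i _ => ?_
  rw [map_smul, norm_smul, mul_comm]
  refine mul_le_mul_of_nonneg_left ?_ (norm_nonneg _)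
  simpa using norm_inner_le_norm (𝕜 := ℝ) (e i) x

theorem toEuclideanLin_mul_apply {l m n : ℕ} (A : Matrix (Fin l) (Fin m) ℝ)
    (B : Matrix (Fin m) (Fin n) ℝ) (x : EuclideanSpace ℝ (Fin n)) :
    (A * B).toEuclideanLin x = A.toEuclideanLin (B.toEuclideanLin x) := by
  simp [Matrix.toLpLin_apply, Matrix.mulVec_mulVec]

/-- The trace norm dominates the operator norm, so `A` stretches the image under `B` of each right
singular vector by at most `trNorm A`. -/
theorem trNorm_mul_le {l m n : ℕ} (A : Matrix (Fin l) (Fin m) ℝ) (B : Matrix (Fin m) (Fin n) ℝ) :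
    trNorm (A * B) ≤ trNorm A * trNorm B := by
  obtain ⟨e, he⟩ := exists_trNorm_eq_sum_norm B
  refine (trNorm_le_sum_norm _ e).trans ?_
  rw [he, Finset.mul_sum]
  refine Finset.sum_le_sum fun i _ => ?_
  rw [toEuclideanLin_mul_apply]
  exact norm_toEuclideanLin_le_trNorm_mul A _

theorem norm_adjoint_apply_le {E F : Type*} [NormedAddCommGroup E] [InnerProductSpace ℝ E]
    [FiniteDimensional ℝ E] [NormedAddCommGroup F] [InnerProductSpace ℝ F] [FiniteDimensional ℝ F]
    (D : E →ₗ[ℝ] F) (hD : ∀ y, ‖D y‖ ≤ ‖y‖) (x : F) : ‖LinearMap.adjoint D x‖ ≤ ‖x‖ := by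
  have h : ‖LinearMap.adjoint D x‖ * ‖LinearMap.adjoint D x‖ ≤ ‖x‖ * ‖LinearMap.adjoint D x‖ := by
    rw [← real_inner_self_eq_norm_mul_norm, LinearMap.adjoint_inner_left]
    exact (real_inner_le_norm _ _).trans (mul_le_mul_of_nonneg_left (hD _) (norm_nonneg _))
  obtain h0 | h0 := (norm_nonneg (LinearMap.adjoint D x)).eq_or_lt
  · rw [← h0]; exact norm_nonneg _
  · exact le_of_mul_le_mul_right h h0

/-- The adjoint of an optimal contraction for the transpose is a contraction giving the same trace
against `X`. -/
theorem trNorm_transpose_le {m n : ℕ} (X : Matrix (Fin m) (Fin n) ℝ) :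
    trNorm X.transpose ≤ trNorm X := by
  obtain ⟨D, hD, h⟩ := exists_trace_comp_eq_trNorm X.transpose
  refine le_trans (le_of_eq ?_) (trace_comp_le_trNorm X _ (norm_adjoint_apply_le D hD))
  rw [← h, LinearMap.trace_comp_comm' _ D,
    LinearMap.trace_eq_sum_inner _ (EuclideanSpace.basisFun (Fin n) ℝ),
    LinearMap.trace_eq_sum_inner _ (EuclideanSpace.basisFun (Fin n) ℝ),
    ← Matrix.conjTranspose_eq_transpose_of_trivial, Matrix.toEuclideanLin_conjTranspose_eq_adjoint]
  refine Finset.sum_congr rfl fun i _ => ?_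
  rw [LinearMap.comp_apply, LinearMap.adjoint_inner_right, real_inner_comm,
    LinearMap.comp_apply, LinearMap.adjoint_inner_right]

theorem trNorm_transpose {m n : ℕ} (X : Matrix (Fin m) (Fin n) ℝ) :
    trNorm X.transpose = trNorm X :=
  le_antisymm (trNorm_transpose_le X) (by simpa using trNorm_transpose_le X.transpose)

/-! ### Continuity and compactness. -/

theorem abs_apply_le_trNorm {m n : ℕ} (X : Matrix (Fin m) (Fin n) ℝ) (i : Fin m) (j : Fin n) :
    |X i j| ≤ trNorm X := by
  have h := norm_toEuclideanLin_le_trNorm_mul X (EuclideanSpace.single j 1)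
  have h' := (PiLp.norm_apply_le (X.toEuclideanLin (EuclideanSpace.single j 1)) i).trans h
  simpa [Matrix.toLpLin_apply] using h'

theorem trNorm_pos {m n : ℕ} {X : Matrix (Fin m) (Fin n) ℝ} (hX : X ≠ 0) : 0 < trNorm X := by
  refine (trNorm_nonneg X).lt_of_ne fun h => hX ?_
  ext i j
  simpa [← h] using abs_apply_le_trNorm X i j

theorem trNorm_le_sum_norm_col {m n : ℕ} (X : Matrix (Fin m) (Fin n) ℝ) :
    trNorm X ≤ ∑ j, ‖WithLp.toLp 2 fun i => X i j‖ := by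
  refine (trNorm_le_sum_norm X (EuclideanSpace.basisFun (Fin n) ℝ)).trans_eq ?_
  refine Finset.sum_congr rfl fun j _ => ?_
  congr 1
  ext i
  simp [Matrix.toLpLin_apply]

theorem continuous_trNorm {m n : ℕ} :
    Continuous (trNorm : Matrix (Fin m) (Fin n) ℝ → ℝ) := by
  rw [continuous_iff_continuousAt]
  intro A
  let g : Matrix (Fin m) (Fin n) ℝ → ℝ := fun B => ∑ j, ‖WithLp.toLp 2 fun i => (B - A) i j‖
  have hg : Continuous g := by
    simp only [g, Matrix.sub_apply]
    fun_prop
  have h0 : Filter.Tendsto g (nhds A) (nhds 0) := by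
    have := hg.tendsto A
    have h1 : g A = 0 := by
      simp only [g, sub_self, Matrix.zero_apply]
      exact Finset.sum_eq_zero fun j _ => norm_zero
    rwa [h1] at this
  rw [ContinuousAt, tendsto_iff_dist_tendsto_zero]
  refine squeeze_zero (fun _ => dist_nonneg) (fun B => ?_) h0
  have h1 := trNorm_add_le (B - A) A
  have h2 := trNorm_add_le (-1 • (B - A)) B
  have h3 : trNorm ((-1 : ℤ) • (B - A)) = trNorm (B - A) := by
    have := trNorm_smul (-1) (B - A)
    simpa using this
  have h4 := trNorm_le_sum_norm_col (B - A)
  rw [h3] at h2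
  have h5 : (-1 : ℤ) • (B - A) + B = A := by simp
  rw [h5] at h2
  rw [sub_add_cancel] at h1
  rw [Real.dist_eq, abs_le]
  constructor <;> simp only [g] <;> linarith

theorem isCompact_trNorm_le {m n : ℕ} (c : ℝ) :
    IsCompact {A : Matrix (Fin m) (Fin n) ℝ | trNorm A ≤ c} := by
  have hK : IsCompact (Set.univ.pi fun _ : Fin m => Set.univ.pi fun _ : Fin n => Set.Icc (-c) c) :=
    isCompact_univ_pi fun _ => isCompact_univ_pi fun _ => isCompact_Icc
  refine hK.of_isClosed_subset (isClosed_le continuous_trNorm continuous_const) fun A hA => ?_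
  intro i _ j _
  exact abs_le.1 ((abs_apply_le_trNorm A i j).trans hA)

theorem isCompact_trNorm_eq {m n : ℕ} (c : ℝ) :
    IsCompact {A : Matrix (Fin m) (Fin n) ℝ | trNorm A = c} :=
  (isCompact_trNorm_le c).of_isClosed_subset (isClosed_eq continuous_trNorm continuous_const)
    fun _ hA => le_of_eq hA

theorem trNorm_zero {m n : ℕ} : trNorm (0 : Matrix (Fin m) (Fin n) ℝ) = 0 := by
  simpa using trNorm_smul 0 (0 : Matrix (Fin m) (Fin n) ℝ)

theorem trNorm_inv_smul_self {m n : ℕ} {A : Matrix (Fin m) (Fin n) ℝ} (hA : A ≠ 0) :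
    trNorm ((trNorm A)⁻¹ • A) = 1 := by
  have h := trNorm_pos hA
  rw [trNorm_smul, abs_of_pos (inv_pos.2 h), inv_mul_cancel₀ h.ne']

/-! ### Attainment of the minima. -/

theorem exists_trNorm_snd_minimal {α : Type*} [TopologicalSpace α] {p q : ℕ} {K : Set α}
    (hK : IsCompact K) {S : Set (α × Matrix (Fin p) (Fin q) ℝ)} (hS : IsClosed S)
    (hne : ∃ x ∈ S, x.1 ∈ K) :
    ∃ x ∈ S, x.1 ∈ K ∧ ∀ y ∈ S, y.1 ∈ K → trNorm x.2 ≤ trNorm y.2 := by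
  obtain ⟨x₀, hx₀, hxK⟩ := hne
  -- Only second components no worse than that of a feasible point matter.
  have hc : IsCompact ((K ×ˢ {A | trNorm A ≤ trNorm x₀.2}) ∩ S) :=
    (hK.prod (isCompact_trNorm_le _)).inter_right hS
  obtain ⟨x, ⟨⟨hx1, hx2⟩, hxS⟩, hmin⟩ := hc.exists_isMinOn ⟨x₀, ⟨hxK, le_refl (trNorm x₀.2)⟩, hx₀⟩
    (continuous_trNorm.comp continuous_snd).continuousOn
  refine ⟨x, hxS, hx1, fun y hy hyK => ?_⟩
  by_cases h : trNorm y.2 ≤ trNorm x₀.2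
  · exact hmin ⟨⟨hyK, h⟩, hy⟩
  · exact le_trans hx2 (not_le.1 h).le

theorem exists_isLeast_biTrValues {m n d : ℕ} {X : Matrix (Fin m) (Fin n) ℝ}
    (hne : (biTrValues d X).Nonempty) : ∃ c, IsLeast (biTrValues d X) c := by
  -- A zero factor cannot be normalized; for `X ≠ 0` none occurs.
  obtain rfl | hX := eq_or_ne X 0
  · refine ⟨0, ⟨0, 0, by simp, by simp [trNorm_zero]⟩, ?_⟩
    rintro _ ⟨U, V, -, rfl⟩
    exact mul_nonneg (trNorm_nonneg _) (trNorm_nonneg _)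
  let S : Set (Matrix (Fin m) (Fin d) ℝ × Matrix (Fin n) (Fin d) ℝ) :=
    {x | X = x.1 * x.2.transpose}
  have hS : IsClosed S := isClosed_eq continuous_const (by fun_prop)
  have key : ∀ (U : Matrix (Fin m) (Fin d) ℝ) (V : Matrix (Fin n) (Fin d) ℝ), X = U * V.transpose → ∃ x ∈ S, trNorm x.1 = 1 ∧
      trNorm x.2 = trNorm U * trNorm V := by
    intro U V h
    have hU : U ≠ 0 := by rintro rfl; simp [hX] at h
    have hpos := trNorm_pos hU
    refine ⟨((trNorm U)⁻¹ • U, trNorm U • V), ?_, trNorm_inv_smul_self hU, ?_⟩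
    · simp [S, Matrix.transpose_smul, smul_smul, hpos.ne', ← h]
    · simp only [trNorm_smul, abs_of_pos hpos]
  obtain ⟨_, U₀, V₀, h₀, -⟩ := hne
  obtain ⟨x₀, hx₀, hx₀1, -⟩ := key U₀ V₀ h₀
  obtain ⟨x, hxS, hx1, hmin⟩ := exists_trNorm_snd_minimal (isCompact_trNorm_eq 1) hS ⟨x₀, hx₀, hx₀1⟩
  refine ⟨trNorm x.2, ⟨x.1, x.2, hxS, ?_⟩, ?_⟩
  · rw [show trNorm x.1 = 1 from hx1, one_mul]
  · rintro _ ⟨U, V, h, rfl⟩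
    obtain ⟨y, hyS, hy1, hy2⟩ := key U V h
    exact hy2 ▸ hmin y hyS hy1

theorem exists_isLeast_triTrValues {m n d : ℕ} {X : Matrix (Fin m) (Fin n) ℝ}
    (hne : (triTrValues d X).Nonempty) : ∃ c, IsLeast (triTrValues d X) c := by
  obtain rfl | hX := eq_or_ne X 0
  · refine ⟨0, ⟨0, 0, 0, by simp, by simp [trNorm_zero]⟩, ?_⟩
    rintro _ ⟨U, V, W, -, rfl⟩
    exact mul_nonneg (mul_nonneg (trNorm_nonneg _) (trNorm_nonneg _)) (trNorm_nonneg _)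
  let S : Set ((Matrix (Fin m) (Fin d) ℝ × Matrix (Fin d) (Fin d) ℝ) × Matrix (Fin n) (Fin d) ℝ) :=
    {x | X = x.1.1 * x.1.2 * x.2.transpose}
  have hS : IsClosed S := isClosed_eq continuous_const (by fun_prop)
  let K : Set (Matrix (Fin m) (Fin d) ℝ × Matrix (Fin d) (Fin d) ℝ) :=
    {A | trNorm A = 1} ×ˢ {B | trNorm B = 1}
  have key : ∀ (U : Matrix (Fin m) (Fin d) ℝ) (V : Matrix (Fin d) (Fin d) ℝ)
      (W : Matrix (Fin n) (Fin d) ℝ), X = U * V * W.transpose → ∃ x ∈ S, x.1 ∈ K ∧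
      trNorm x.2 = trNorm U * trNorm V * trNorm W := by
    intro U V W h
    have hU : U ≠ 0 := by rintro rfl; simp [hX] at h
    have hV : V ≠ 0 := by rintro rfl; simp [hX] at h
    have hUp := trNorm_pos hU
    have hVp := trNorm_pos hV
    refine ⟨(((trNorm U)⁻¹ • U, (trNorm V)⁻¹ • V), (trNorm U * trNorm V) • W), ?_,
      ⟨trNorm_inv_smul_self hU, trNorm_inv_smul_self hV⟩, ?_⟩
    · have hc : trNorm U * trNorm V * ((trNorm V)⁻¹ * (trNorm U)⁻¹) = 1 := by field_simp
      simp only [S, Set.mem_ofPred_eq, Matrix.transpose_smul, Matrix.smul_mul, Matrix.mul_smul,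
        smul_smul, ← h, hc, one_smul]
    · simp only [trNorm_smul, abs_of_pos (mul_pos hUp hVp)]
  obtain ⟨_, U₀, V₀, W₀, h₀, -⟩ := hne
  obtain ⟨x₀, hx₀, hx₀1, -⟩ := key U₀ V₀ W₀ h₀
  obtain ⟨x, hxS, hx1, hmin⟩ := exists_trNorm_snd_minimal
    ((isCompact_trNorm_eq 1).prod (isCompact_trNorm_eq 1)) hS ⟨x₀, hx₀, hx₀1⟩
  refine ⟨trNorm x.2, ⟨x.1.1, x.1.2, x.2, hxS, ?_⟩, ?_⟩
  · rw [show trNorm x.1.1 = 1 from hx1.1, show trNorm x.1.2 = 1 from hx1.2, one_mul, one_mul]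
  · rintro _ ⟨U, V, W, h, rfl⟩
    obtain ⟨y, hyS, hy1, hy2⟩ := key U V W h
    exact hy2 ▸ hmin y hyS hy1

/-! ### Explicit factorizations and upper bounds. -/

/-- A rank-revealing factorization obtained by splitting each singular value evenly between the
two factors. -/
theorem exists_balanced_factorization {m n d : ℕ} (X : Matrix (Fin m) (Fin n) ℝ)
    (hd : X.rank ≤ d) :
    ∃ (U : Matrix (Fin m) (Fin d) ℝ) (V : Matrix (Fin n) (Fin d) ℝ),
      X = U * V.transpose ∧
      (∀ k : Fin d, X.rank ≤ k → ∀ i, U i k = 0) ∧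
      trNorm U ≤ ∑ i ∈ Finset.range X.rank, √(matSingularValue X i) ∧
      trNorm V ≤ ∑ i ∈ Finset.range X.rank, √(matSingularValue X i) := by
  obtain ⟨e, he, -⟩ := exists_rightSingularBasis X
  set s := matSingularValue X
  have hs : ∀ i, 0 ≤ s i := matSingularValue_nonneg X
  -- Indexing by ℕ lets sums over `Fin d` and `Fin n` both be truncated at the rank, as `d` and `n`
  -- are not comparable.
  let u : ℕ → EuclideanSpace ℝ (Fin m) := fun k =>
    if h : k < n then (√(s k))⁻¹ • X.toEuclideanLin (e ⟨k, h⟩) else 0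
  let v : ℕ → EuclideanSpace ℝ (Fin n) := fun k =>
    if h : k < n then √(s k) • e ⟨k, h⟩ else 0
  have hu : ∀ k, ‖u k‖ ≤ √(s k) := by
    intro k
    by_cases h : k < n
    · simp only [u, dif_pos h, norm_smul, he, norm_inv, Real.norm_eq_abs,
        abs_of_nonneg (Real.sqrt_nonneg _)]
      rw [inv_mul_eq_div]
      exact (Real.div_sqrt).le
    · simp [u, h]
  have hv : ∀ k, ‖v k‖ ≤ √(s k) := by
    intro k
    by_cases h : k < n
    · simp [v, dif_pos h, norm_smul, abs_of_nonneg (Real.sqrt_nonneg _)]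
    · simp [v, h]
  have hzero : ∀ k, X.rank ≤ k → √(s k) = 0 := fun k hk => by
    simp [s, matSingularValue_eq_zero X hk]
  have hu0 : ∀ k, X.rank ≤ k → u k = 0 := fun k hk =>
    norm_le_zero_iff.1 ((hu k).trans_eq (hzero k hk))
  have hsum : ∀ k : Fin n, ∀ i j, u k i * v k j = X.toEuclideanLin (e k) i * e k j := by
    intro k i j
    simp only [u, v, dif_pos k.2, PiLp.smul_apply, smul_eq_mul, Fin.eta]
    by_cases h : √(s k) = 0
    · have h0 : X.toEuclideanLin (e k) = 0 := by
        rw [← norm_eq_zero, he]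
        exact (Real.sqrt_eq_zero (hs _)).1 h
      simp [h0]
    · field_simp
  have hbound : ∀ (p : ℕ) (w : ℕ → EuclideanSpace ℝ (Fin p)), (∀ k, ‖w k‖ ≤ √(s k)) →
      trNorm (Matrix.of fun i (k : Fin d) => w k i) ≤ ∑ i ∈ Finset.range X.rank, √(s i) := by
    intro p w hw
    refine (trNorm_le_sum_norm_col _).trans ?_
    rw [← Finset.sum_range_eq_of_forall_ge_eq_zero hd hzero,
      ← Fin.sum_univ_eq_sum_range (fun i => √(s i))]
    exact Finset.sum_le_sum fun k _ => hw k
  refine ⟨Matrix.of fun i k => u k i, Matrix.of fun j k => v k j, ?_, ?_, hbound m u hu,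
    hbound n v hv⟩
  · ext i j
    have h0 : ∀ k, X.rank ≤ k → u k i * v k j = 0 := fun k hk => by simp [hu0 k hk]
    simp only [Matrix.mul_apply, Matrix.transpose_apply, Matrix.of_apply]
    rw [Fin.sum_univ_eq_sum_range (fun k => u k i * v k j),
      Finset.sum_range_eq_of_forall_ge_eq_zero hd h0,
      ← Finset.sum_range_eq_of_forall_ge_eq_zero (rank_le_right X) h0,
      ← Fin.sum_univ_eq_sum_range (fun k => u k i * v k j)]
    simp only [hsum]
    have hx := congrArg (fun x => X.toEuclideanLin x i) (e.sum_repr' (EuclideanSpace.single j 1))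
    simpa [map_sum, Matrix.toLpLin_apply, EuclideanSpace.inner_single_right, mul_comm] using hx.symm
  · intro k hk i
    simp [hu0 k hk]

theorem trNorm_diagonal_indicator_le {d r : ℕ} (hd : r ≤ d) :
    trNorm (Matrix.diagonal fun k : Fin d => if (k : ℕ) < r then (1 : ℝ) else 0) ≤ r := by
  refine (trNorm_le_sum_norm_col _).trans ?_
  have hcol : ∀ k : Fin d, ‖(WithLp.toLp 2 fun i => (Matrix.diagonal fun k : Fin d =>
      if (k : ℕ) < r then (1 : ℝ) else 0) i k : EuclideanSpace ℝ (Fin d))‖ =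
      if (k : ℕ) < r then (1 : ℝ) else 0 := by
    intro k
    have : (WithLp.toLp 2 fun i => (Matrix.diagonal fun k : Fin d =>
        if (k : ℕ) < r then (1 : ℝ) else 0) i k : EuclideanSpace ℝ (Fin d)) =
        EuclideanSpace.single k (if (k : ℕ) < r then (1 : ℝ) else 0) := by
      ext i
      by_cases h : i = k
      · subst h; simp
      · simp [h]
    rw [this, PiLp.norm_single]
    split_ifs <;> simp
  simp only [hcol]
  rw [Fin.sum_univ_eq_sum_range (fun k => if k < r then (1 : ℝ) else 0),
    Finset.sum_range_eq_of_forall_ge_eq_zero hd fun i hi => if_neg (not_lt.2 hi),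
    Finset.sum_congr rfl fun i hi => if_pos (Finset.mem_range.1 hi)]
  simp

theorem sq_sum_sqrt_matSingularValue_le {m n : ℕ} (X : Matrix (Fin m) (Fin n) ℝ) :
    (∑ i ∈ Finset.range X.rank, √(matSingularValue X i)) ^ 2 ≤ X.rank * trNorm X := by
  refine (sq_sum_le_card_mul_sum_sq (s := Finset.range X.rank)).trans_eq ?_
  rw [trNorm_eq_sum_range_rank, Finset.card_range]
  simp only [Real.sq_sqrt (matSingularValue_nonneg X _)]

theorem exists_mem_biTrValues_le {m n d : ℕ} (X : Matrix (Fin m) (Fin n) ℝ) (hd : X.rank ≤ d) :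
    ∃ c ∈ biTrValues d X, c ≤ X.rank * trNorm X := by
  obtain ⟨U, V, hX, -, hU, hV⟩ := exists_balanced_factorization X hd
  refine ⟨_, ⟨U, V, hX, rfl⟩, le_trans ?_ (sq_sum_sqrt_matSingularValue_le X)⟩
  rw [sq]
  exact mul_le_mul hU hV (trNorm_nonneg _) ((trNorm_nonneg _).trans hU)

theorem exists_mem_triTrValues_le {m n d : ℕ} (X : Matrix (Fin m) (Fin n) ℝ) (hd : X.rank ≤ d) :
    ∃ c ∈ triTrValues d X, c ≤ (X.rank : ℝ) ^ 2 * trNorm X := by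
  obtain ⟨U, V, hX, h0, hU, hV⟩ := exists_balanced_factorization X hd
  -- The identity would give the bound `d`; this projection gives the rank, and fixes `U` because
  -- the later columns of `U` vanish.
  let P : Matrix (Fin d) (Fin d) ℝ := Matrix.diagonal fun k => if (k : ℕ) < X.rank then 1 else 0
  have hUP : U * P = U := by
    ext i k
    simp only [P, Matrix.mul_diagonal]
    split_ifs with h
    · simp
    · simp [h0 k (not_lt.1 h) i]
  refine ⟨_, ⟨U, P, V, by rw [hUP]; exact hX, rfl⟩, ?_⟩
  have hUV : trNorm U * trNorm V ≤ X.rank * trNorm X := by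
    refine le_trans ?_ (sq_sum_sqrt_matSingularValue_le X)
    rw [sq]
    exact mul_le_mul hU hV (trNorm_nonneg _) ((trNorm_nonneg _).trans hU)
  calc trNorm U * trNorm P * trNorm V = trNorm P * (trNorm U * trNorm V) := by ring
    _ ≤ X.rank * (X.rank * trNorm X) :=
      mul_le_mul (trNorm_diagonal_indicator_le hd) hUV
        (mul_nonneg (trNorm_nonneg _) (trNorm_nonneg _)) (Nat.cast_nonneg _)
    _ = (X.rank : ℝ) ^ 2 * trNorm X := by ring

theorem mainTheorem9 (m n d r : ℕ) (X : Matrix (Fin m) (Fin n) ℝ) (hr : X.rank = r) (hd : r ≤ d) :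
    IsLeast (biTrValues d X) (biTrNorm d X) ∧
    IsLeast (triTrValues d X) (triTrNorm d X) ∧
    (trNorm X ≤ biTrNorm d X ∧ biTrNorm d X ≤ r * trNorm X) ∧
    (trNorm X ≤ biTrNorm d X ∧ biTrNorm d X ≤ triTrNorm d X ∧
      triTrNorm d X ≤ (r : ℝ) ^ 2 * trNorm X) := by
  subst hr
  obtain ⟨b, hb, hbr⟩ := exists_mem_biTrValues_le X hd
  obtain ⟨t, ht, htr⟩ := exists_mem_triTrValues_le X hd
  have hbi : IsLeast (biTrValues d X) (biTrNorm d X) := by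
    obtain ⟨c, hc⟩ := exists_isLeast_biTrValues ⟨b, hb⟩
    rwa [biTrNorm, hc.csInf_eq]
  have htri : IsLeast (triTrValues d X) (triTrNorm d X) := by
    obtain ⟨c, hc⟩ := exists_isLeast_triTrValues ⟨t, ht⟩
    rwa [triTrNorm, hc.csInf_eq]
  have hlow : trNorm X ≤ biTrNorm d X := by
    obtain ⟨U, V, h, hc⟩ := hbi.1
    rw [hc, ← trNorm_transpose V, congrArg trNorm h]
    exact trNorm_mul_le _ _
  have hmid : biTrNorm d X ≤ triTrNorm d X := by
    obtain ⟨U, V, W, h, hc⟩ := htri.1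
    rw [hc]
    exact (hbi.2 ⟨U * V, W, h, rfl⟩).trans
      (mul_le_mul_of_nonneg_right (trNorm_mul_le U V) (trNorm_nonneg W))
  exact ⟨hbi, htri, ⟨hlow, (hbi.2 hb).trans hbr⟩, hlow, hmid, (htri.2 ht).trans htr⟩
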